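/- Let $\mathcal{A}$ and $\mathcal{B}$ be abelian categories with enough projective objects. For an abelian category $\mathcal{C}$, let $D^b(\mathcal{C})$ be its bounded derived category, into which $\mathcal{C}$ is embedded as the complexes concentrated in degree $0$, and let $\underline{\mathcal{C}}$ be its stable category: it has the same objects as $\mathcal{C}$, and its morphisms are the morphisms of $\mathcal{C}$ modulo those factoring through a projective object. Write $\underline{f}$ for the class of $f$. A triangle functor $F\colon D^b(\mathcal{A})\to D^b(\mathcal{B})$ is called non-negative if (1) $H^i(F(X))=0$ for all $X\in\mathcal{A}$ and all $i<0$, and (2) for every projective object $P$ of $\mathcal{A}$, $F(P)$ is isomorphic in $D^b(\mathcal{B})$ to a bounded complex of projective objects of $\mathcal{B}$ with zero terms in all negative degrees. Let $F$ be a non-negative triangle functor. For each $X\in\mathcal{A}$ choose a distinguished triangle $$\xi_X:\quad U_X\longrightarrow F(X)\xrightarrow{\ \pi_X\ } M_X\longrightarrow U_X[1]$$ in $D^b(\mathcal{B})$ with $M_X\in\mathcal{B}$ and with $U_X$ isomorphic to a complex $0\to P^1\to\cdots\to P^{n}\to 0$ of projective objects of $\mathcal{B}$ in degrees $1,\dots,n$,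 for some $n>0$ depending on $X$. The stable functor $\bar F\colon\underline{\mathcal{A}}\to\underline{\mathcal{B}}$ of $F$ defined by these choices sends $X$ to $M_X$ and sends $\underline{f}$, for $f\colon X\to Y$ in $\mathcal{A}$, to $\underline{b_f}$, where $b_f\colon M_X\to M_Y$ is any morphism of $\mathcal{B}$ such that the composite of $\pi_X$ followed by $b_f$ equals the composite of $F(f)$ followed by $\pi_Y$. **Theorem.** (a) Let $F\colon D^b(\mathcal{A})\to D^b(\mathcal{B})$ be a non-negative triangle functor. Then a triangle $\xi_X$ as above exists for every $X\in\mathcal{A}$, and any two choices $(\xi_X)_X$ and $(\xi'_X)_X$ of such triangles define isomorphic stable functors $\underline{\mathcal{A}}\to\underline{\mathcal{B}}$. (b) Let $F_1,F_2\colon D^b(\mathcal{A})\to D^b(\mathcal{B})$ be non-negative triangle functors that are isomorphic as functors. Then, for any choices of triangles defining them, the stable functors $\bar F_1,\bar F_2\colon\underline{\mathcal{A}}\to\underline{\mathcal{B}}$ are isomorphic. -/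

import Mathlib

open CategoryTheory CategoryTheory.Limits CategoryTheory.Pretriangulated ZeroObject

universe w w₁ w₂ v v₁ v₂ u u₁ u₂

noncomputable section

namespace StableFunctors

/-! ### The stable category of an abelian category -/

section StableCategory

variable (A : Type u) [Category.{v} A] [Abelian A]

/-- Two parallel morphisms are identified in the stable category when their difference
factors through a projective object. -/
def stableRel : HomRel A := fun X Y f g =>
  ∃ (P : A) (_ : Projective P) (a : X ⟶ P) (b : P ⟶ Y), f - g = a ≫ b

lemma stableRel_add ⦃X Y : A⦄ (f₁ f₂ g₁ g₂ : X ⟶ Y) (hf : stableRel A f₁ f₂)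
    (hg : stableRel A g₁ g₂) : stableRel A (f₁ + g₁) (f₂ + g₂) := by
  obtain ⟨P, hP, a, b, h⟩ := hf
  obtain ⟨P', hP', a', b', h'⟩ := hg
  refine ⟨P ⊞ P', inferInstance, biprod.lift a a', biprod.desc b b', ?_⟩
  rw [biprod.lift_desc, ← h, ← h']
  abel

instance : Congruence (stableRel A) where
  comp_left := by
    rintro X Y Z f g g' ⟨P, hP, a, b, h⟩
    exact ⟨P, hP, f ≫ a, b, by rw [← Preadditive.comp_sub, h, Category.assoc]⟩
  comp_right := by
    rintro X Y Z f f' g ⟨P, hP, a, b, h⟩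
    exact ⟨P, hP, a, b ≫ g, by rw [← Preadditive.sub_comp, h, Category.assoc]⟩
  equivalence :=
    { refl := fun f => ⟨0, inferInstance, 0, 0, by simp⟩
      symm := by
        rintro f g ⟨P, hP, a, b, h⟩
        exact ⟨P, hP, -a, b, by rw [← neg_sub, h, Preadditive.neg_comp]⟩
      trans := by
        rintro f g k ⟨P, hP, a, b, h⟩ ⟨P', hP', a', b', h'⟩
        refine ⟨P ⊞ P', inferInstance, biprod.lift a a', biprod.desc b b', ?_⟩
        rw [biprod.lift_desc, ← h, ← h']
        abel }

/-- The stable category of `A`: the objects are those of `A`, and the morphisms are those of `A`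
modulo the morphisms which factor through a projective object. -/
abbrev StableCat := CategoryTheory.Quotient (stableRel A)

instance : Preadditive (StableCat A) :=
  CategoryTheory.Quotient.preadditive (stableRel A) (stableRel_add A)

/-- The quotient functor from `A` to its stable category. -/
abbrev toStable : A ⥤ StableCat A := CategoryTheory.Quotient.functor (stableRel A)

end StableCategory

lemma isKProjective_of_bounded {A : Type u} [Category.{v} A] [Abelian A]
    {K : CochainComplex A ℤ} (hK : ∀ i, Projective (K.X i)) {a b : ℤ}
    (hK' : ∀ i, i < a ∨ b < i → IsZero (K.X i)) : K.IsKProjective := by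
  have : K.IsStrictlyLE b := by
    rw [CochainComplex.isStrictlyLE_iff]
    exact fun i hi => hK' i (Or.inr hi)
  exact CochainComplex.isKProjective_of_projective K b

/-! ### The bounded derived category -/

section Bounded

variable (A : Type u) [Category.{v} A] [Abelian A] [HasDerivedCategory.{w} A]

/-- The bounded derived category `D^b(A)`, as the full triangulated subcategory of the derived
category on the objects with bounded cohomology. -/
abbrev Db := (DerivedCategory.TStructure.t (C := A)).bounded.FullSubcategory

/-- The inclusion `D^b(A) ⥤ D(A)`. -/
abbrev Db.ι : Db A ⥤ DerivedCategory A := (DerivedCategory.TStructure.t (C := A)).bounded.ι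

/-- The embedding `A ⥤ D^b(A)` which sends an object to the complex concentrated in degree `0`. -/
def Db.single : A ⥤ Db A :=
  (DerivedCategory.TStructure.t (C := A)).bounded.lift (DerivedCategory.singleFunctor A 0)
    (fun X => ⟨⟨0, (inferInstance : ((DerivedCategory.singleFunctor A 0).obj X).IsGE 0)⟩,
      ⟨0, (inferInstance : ((DerivedCategory.singleFunctor A 0).obj X).IsLE 0)⟩⟩)

instance : (Db.single A).Additive where
  map_add {_ _ f g} := (Db.ι A).map_injective
    ((DerivedCategory.singleFunctor A 0).map_add (f := f) (g := g))

variable {A}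

/-- `IsProjComplex a b Y` says that `Y` is isomorphic, in the derived category, to a complex of
projective objects `0 ⟶ P^a ⟶ ⋯ ⟶ P^b ⟶ 0` concentrated in degrees `a, …, b`. -/
def IsProjComplex (a b : ℤ) (Y : DerivedCategory A) : Prop :=
  ∃ K : CochainComplex A ℤ, (∀ i, Projective (K.X i)) ∧
    (∀ i, i < a ∨ b < i → IsZero (K.X i)) ∧ Nonempty (Y ≅ DerivedCategory.Q.obj K)

lemma exists_Q_map {K L : CochainComplex A ℤ} [K.IsKProjective]
    (c : DerivedCategory.Q.obj K ⟶ DerivedCategory.Q.obj L) :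
    ∃ g : K ⟶ L, DerivedCategory.Q.map g = c := by
  obtain ⟨g', hg'⟩ := (CochainComplex.IsKProjective.Qh_map_bijective K
    ((HomotopyCategory.quotient _ _).obj L)).surjective
    ((DerivedCategory.quotientCompQhIso A).hom.app K ≫ c ≫
      (DerivedCategory.quotientCompQhIso A).inv.app L)
  obtain ⟨g, rfl⟩ := (HomotopyCategory.quotient _ _).map_surjective g'
  refine ⟨g, ?_⟩
  have h := DerivedCategory.quotientCompQhIso_hom_naturality g
  rw [hg'] at h
  simpa using h.symm

/-- A morphism in the derived category from a bounded complex of projective objects in degrees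
`≥ 0` to an object placed in degree `0` factors through the degree `0` term. -/
lemma exists_fac_of_isProjComplex {K : CochainComplex A ℤ} (hK : ∀ i, Projective (K.X i)) {b : ℤ}
    (hK' : ∀ i, i < 0 ∨ b < i → IsZero (K.X i)) {N : A}
    (c : DerivedCategory.Q.obj K ⟶ (DerivedCategory.singleFunctor A 0).obj N) :
    ∃ (p : DerivedCategory.Q.obj K ⟶ (DerivedCategory.singleFunctor A 0).obj (K.X 0))
      (q : K.X 0 ⟶ N), c = p ≫ (DerivedCategory.singleFunctor A 0).map q := by
  have := isKProjective_of_bounded hK hK'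
  obtain ⟨g, hg⟩ := exists_Q_map (L := (HomologicalComplex.single A _ 0).obj N) c
  have hz : ∀ i : ℤ, (ComplexShape.up ℤ).Rel i 0 → K.d i 0 ≫ 𝟙 (K.X 0) = 0 := by
    intro i hi
    refine (hK' i (Or.inl ?_)).eq_of_src _ _
    simp only [ComplexShape.up_Rel] at hi
    omega
  let p := HomologicalComplex.mkHomToSingle (K := K) (𝟙 (K.X 0)) hz
  let q : K.X 0 ⟶ N := g.f 0 ≫ (HomologicalComplex.singleObjXSelf (ComplexShape.up ℤ) 0 N).hom
  refine ⟨DerivedCategory.Q.map p, q, ?_⟩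
  have hpq : g = p ≫ (HomologicalComplex.single A (ComplexShape.up ℤ) 0).map q := by
    apply HomologicalComplex.to_single_hom_ext
    simp [p, q, HomologicalComplex.single_map_f_self]
  rw [← hg, hpq, Functor.map_comp]
  rfl

/-- There is no nonzero morphism from a bounded complex of projective objects in degrees `≥ a`
to a complex in degrees `≤ b` if `b < a`. -/
lemma eq_zero_of_isProjComplex {K : CochainComplex A ℤ} (hK : ∀ i, Projective (K.X i)) {a b n : ℤ}
    (hK' : ∀ i, i < a ∨ n < i → IsZero (K.X i)) {L : CochainComplex A ℤ} [L.IsStrictlyLE b]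
    (hab : b < a) (c : DerivedCategory.Q.obj K ⟶ DerivedCategory.Q.obj L) : c = 0 := by
  have := isKProjective_of_bounded hK hK'
  obtain ⟨g, rfl⟩ := exists_Q_map c
  have : g = 0 := by
    ext i
    rcases lt_or_ge i a with hi | hi
    · exact (hK' i (Or.inl hi)).eq_of_src _ _
    · exact (L.isZero_of_isStrictlyLE b i (by omega)).eq_of_tgt _ _
  rw [this, Functor.map_zero]

/-- Morphisms from a complex of projectives in degrees `≥ 1` to an object in degree `0` vanish. -/
lemma IsProjComplex.hom_eq_zero {Y : DerivedCategory A} {n : ℤ} (hY : IsProjComplex 1 n Y)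
    {N : A} (c : Y ⟶ (DerivedCategory.singleFunctor A 0).obj N) : c = 0 := by
  obtain ⟨K, hK, hK', ⟨e⟩⟩ := hY
  rw [← cancel_epi e.inv, comp_zero]
  exact eq_zero_of_isProjComplex hK hK' (b := 0)
    (L := (HomologicalComplex.single A (ComplexShape.up ℤ) 0).obj N) (by omega) _

/-- Morphisms from a complex of projectives in degrees `≥ 0` to an object in degree `-1` vanish. -/
lemma IsProjComplex.hom_shift_eq_zero {Y : DerivedCategory A} {n : ℤ} (hY : IsProjComplex 0 n Y)
    {N : A} (c : Y ⟶ ((DerivedCategory.singleFunctor A 0).obj N)⟦(1 : ℤ)⟧) : c = 0 := by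
  obtain ⟨K, hK, hK', ⟨e⟩⟩ := hY
  let L : CochainComplex A ℤ := (HomologicalComplex.single A (ComplexShape.up ℤ) 0).obj N
  have : L.IsStrictlyLE 0 := inferInstance
  have : (L⟦(1 : ℤ)⟧).IsStrictlyLE (-1) := L.isStrictlyLE_shift 0 1 (-1) (by omega)
  let e' : ((DerivedCategory.singleFunctor A 0).obj N)⟦(1 : ℤ)⟧ ≅
    DerivedCategory.Q.obj (L⟦(1 : ℤ)⟧) := ((DerivedCategory.Q (C := A)).commShiftIso (1 : ℤ)).symm.app L
  rw [← cancel_epi e.inv, ← cancel_mono e'.hom, comp_zero, zero_comp]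
  exact eq_zero_of_isProjComplex hK hK' (b := -1) (L := L⟦(1 : ℤ)⟧) (by omega) _

/-- If `Y` is a complex of projectives in degrees `1, …, n`, then any morphism in the derived
category `M ⟶ Y⟦1⟧ ⟶ N`, for `M` and `N` in `A`, comes from a morphism `M ⟶ N` in `A` which
factors through a projective object. -/
lemma IsProjComplex.exists_projective_fac {Y : DerivedCategory A} {n : ℤ}
    (hY : IsProjComplex 1 n Y) {M N : A} (m : (DerivedCategory.singleFunctor A 0).obj M ⟶ Y⟦(1 : ℤ)⟧)
    (c : Y⟦(1 : ℤ)⟧ ⟶ (DerivedCategory.singleFunctor A 0).obj N) :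
    ∃ (P : A) (_ : Projective P) (a : M ⟶ P) (b : P ⟶ N),
      m ≫ c = (DerivedCategory.singleFunctor A 0).map (a ≫ b) := by
  obtain ⟨K, hK, hK', ⟨e⟩⟩ := hY
  let e' : Y⟦(1 : ℤ)⟧ ≅ DerivedCategory.Q.obj (K⟦(1 : ℤ)⟧) :=
    (shiftFunctor (DerivedCategory A) (1 : ℤ)).mapIso e ≪≫
      ((DerivedCategory.Q (C := A)).commShiftIso (1 : ℤ)).symm.app K
  obtain ⟨p, q, h⟩ := exists_fac_of_isProjComplex (K := K⟦(1 : ℤ)⟧) (b := n - 1)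
    (fun i => hK (i + 1)) (fun i hi => hK' (i + 1) (by omega)) (e'.inv ≫ c)
  obtain ⟨a, ha⟩ := (DerivedCategory.singleFunctor A 0).map_surjective (m ≫ e'.hom ≫ p)
  refine ⟨(K⟦(1 : ℤ)⟧).X 0, hK (0 + 1), a, q, ?_⟩
  rw [Functor.map_comp, ha, Category.assoc, Category.assoc, ← h, Iso.hom_inv_id_assoc]

end Bounded

/-! ### Non-negative functors and their stable functors -/

section Functors

variable {A : Type u₁} [Category.{v₁} A] [Abelian A] [HasDerivedCategory.{w₁} A]
  {B : Type u₂} [Category.{v₂} B] [Abelian B] [HasDerivedCategory.{w₂} B]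

/-- A functor `F : D^b(A) ⥤ D^b(B)` is non-negative if it sends the objects of `A` to complexes
without cohomology in negative degrees, and the projective objects of `A` to bounded complexes of
projective objects without terms in negative degrees. -/
structure IsNonNegative (F : Db A ⥤ Db B) : Prop where
  isZero_homology : ∀ (X : A) (i : ℤ), i < 0 →
    IsZero ((DerivedCategory.homologyFunctor B i).obj ((Db.ι B).obj (F.obj ((Db.single A).obj X))))
  isProjComplex : ∀ (P : A), Projective P →
    ∃ n : ℤ, IsProjComplex 0 n ((Db.ι B).obj (F.obj ((Db.single A).obj P)))

/-- A distinguished triangle `U ⟶ F(X) ⟶ M ⟶ U⟦1⟧` in `D^b(B)` with `M` in `B` and `U` isomorphic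
to a complex of projective objects of `B` in degrees `1, …, n`, for some `n > 0`. -/
structure StableTriangle (F : Db A ⥤ Db B) (X : A) where
  U : Db B
  M : B
  i : U ⟶ F.obj ((Db.single A).obj X)
  π : F.obj ((Db.single A).obj X) ⟶ (Db.single B).obj M
  μ : (Db.single B).obj M ⟶ U⟦(1 : ℤ)⟧
  distinguished : Triangle.mk i π μ ∈ distTriang (Db B)
  isProjComplex : ∃ n : ℤ, 0 < n ∧ IsProjComplex 1 n ((Db.ι B).obj U)

namespace StableTriangle

variable {F : Db A ⥤ Db B}

/-- For a morphism `φ : F(X) ⟶ F(Y)`, there is a morphism `b : M_X ⟶ M_Y` in `B` such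
that `π_X ≫ b = φ ≫ π_Y`. -/
lemma exists_map {X Y : A} (S : StableTriangle F X) (T : StableTriangle F Y)
    (φ : F.obj ((Db.single A).obj X) ⟶ F.obj ((Db.single A).obj Y)) :
    ∃ b : S.M ⟶ T.M, S.π ≫ (Db.single B).map b = φ ≫ T.π := by
  obtain ⟨n, -, hn⟩ := S.isProjComplex
  obtain ⟨c, hc⟩ := Triangle.yoneda_exact₂ _ S.distinguished (φ ≫ T.π) (by
    apply (Db.ι B).map_injective
    rw [Functor.map_zero]
    exact hn.hom_eq_zero (N := T.M) _)
  obtain ⟨b, hb⟩ := (DerivedCategory.singleFunctor B 0).map_surjective ((Db.ι B).map c)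
  refine ⟨b, ?_⟩
  have : (Db.single B).map b = c := (Db.ι B).map_injective hb
  rw [this]
  exact hc.symm

/-- Morphisms out of `M_X` which agree on `F(X)` are equal in the stable category. -/
lemma stableRel_of_comp_eq {X : A} (S : StableTriangle F X) {N : B} (b b' : S.M ⟶ N)
    (h : S.π ≫ (Db.single B).map b = S.π ≫ (Db.single B).map b') : stableRel B b b' := by
  obtain ⟨n, -, hn⟩ := S.isProjComplex
  obtain ⟨c, hc⟩ := Triangle.yoneda_exact₃ _ S.distinguished
    ((Db.single B).map b - (Db.single B).map b') (by
      change S.π ≫ _ = 0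
      rw [Preadditive.comp_sub, h, sub_self])
  let e := ((Db.ι B).commShiftIso (1 : ℤ)).app S.U
  obtain ⟨P, hP, x, y, hxy⟩ := hn.exists_projective_fac (M := S.M) (N := N)
    ((Db.ι B).map S.μ ≫ e.hom) (e.inv ≫ (Db.ι B).map c)
  refine ⟨P, hP, x, y, (DerivedCategory.singleFunctor B 0).map_injective ?_⟩
  refine Eq.trans ?_ hxy
  refine Eq.trans ?_ (Category.assoc ((Db.ι B).map S.μ) e.hom (e.inv ≫ (Db.ι B).map c)).symm
  rw [Iso.hom_inv_id_assoc, Functor.map_sub]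
  exact (congrArg (Db.ι B).map hc).trans ((Db.ι B).map_comp _ _)

/-- If `P` is projective and `F` is non-negative, then `M_P` is projective. -/
lemma projective_M (hF : IsNonNegative F) {P : A} (hP : Projective P) (S : StableTriangle F P) :
    Projective S.M := by
  obtain ⟨n, -, hn⟩ := S.isProjComplex
  obtain ⟨m, hm⟩ := hF.isProjComplex P hP
  refine ⟨fun {E N} f p hp => ?_⟩
  let T : ShortComplex B := ShortComplex.mk (kernel.ι p) p (kernel.condition p)
  have hT : T.ShortExact :=
    { exact := ShortComplex.exact_of_f_is_kernel _ (kernelIsKernel p)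
      mono_f := inferInstanceAs (Mono (kernel.ι p))
      epi_g := hp }
  have hS := (Db.ι B).map_distinguished _ S.distinguished
  have h₀ : (DerivedCategory.singleFunctor B 0).map f ≫ hT.singleδ = 0 := by
    obtain ⟨c, hc⟩ := Triangle.yoneda_exact₃ _ hS
      ((DerivedCategory.singleFunctor B 0).map f ≫ hT.singleδ) (hm.hom_shift_eq_zero _)
    obtain ⟨c', rfl⟩ : ∃ c', c'⟦(1 : ℤ)⟧' = c :=
      (shiftFunctor (DerivedCategory B) (1 : ℤ)).map_surjective c
    have : c' = 0 := hn.hom_eq_zero c'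
    refine hc.trans ?_
    rw [this, Functor.map_zero, comp_zero]
    rfl
  obtain ⟨g, hg⟩ := Triangle.coyoneda_exact₃ _ hT.singleTriangle_distinguished _ h₀
  obtain ⟨g', rfl⟩ := (DerivedCategory.singleFunctor B 0).map_surjective g
  refine ⟨g', (DerivedCategory.singleFunctor B 0).map_injective ?_⟩
  rw [Functor.map_comp]
  exact hg.symm

end StableTriangle

variable (F : Db A ⥤ Db B)

/-- Given triangles `U_X ⟶ F(X) ⟶ M_X ⟶ U_X⟦1⟧` for all `X` in `A`, the functor from `A` to the
stable category of `B` sending `X` to `M_X`, and `f : X ⟶ Y` to the class of any morphism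
`b : M_X ⟶ M_Y` such that `π_X ≫ b = F(f) ≫ π_Y`. -/
def preStableFunctor (ξ : ∀ X : A, StableTriangle F X) : A ⥤ StableCat B where
  obj X := (toStable B).obj (ξ X).M
  map {X Y} f :=
    (toStable B).map ((ξ X).exists_map (ξ Y) (F.map ((Db.single A).map f))).choose
  map_id X := by
    rw [← (toStable B).map_id]
    apply CategoryTheory.Quotient.sound
    apply (ξ X).stableRel_of_comp_eq
    rw [((ξ X).exists_map (ξ X) (F.map ((Db.single A).map (𝟙 X)))).choose_spec]
    simp
  map_comp {X Y Z} f g := by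
    rw [← (toStable B).map_comp]
    apply CategoryTheory.Quotient.sound
    apply (ξ X).stableRel_of_comp_eq
    rw [((ξ X).exists_map (ξ Z) (F.map ((Db.single A).map (f ≫ g)))).choose_spec,
      Functor.map_comp (Db.single B), ← Category.assoc,
      ((ξ X).exists_map (ξ Y) (F.map ((Db.single A).map f))).choose_spec, Category.assoc,
      ((ξ Y).exists_map (ξ Z) (F.map ((Db.single A).map g))).choose_spec]
    simp

lemma preStableFunctor_map (ξ : ∀ X : A, StableTriangle F X) {X Y : A} (f : X ⟶ Y)
    (b : (ξ X).M ⟶ (ξ Y).M)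
    (hb : (ξ X).π ≫ (Db.single B).map b = F.map ((Db.single A).map f) ≫ (ξ Y).π) :
    (preStableFunctor F ξ).map f = (toStable B).map b := by
  apply CategoryTheory.Quotient.sound
  apply (ξ X).stableRel_of_comp_eq
  rw [((ξ X).exists_map (ξ Y) (F.map ((Db.single A).map f))).choose_spec, hb]

lemma preStableFunctor_map_eq [F.Additive] (hF : IsNonNegative F)
    (ξ : ∀ X : A, StableTriangle F X) (X Y : A) (f g : X ⟶ Y) (h : stableRel A f g) :
    (preStableFunctor F ξ).map f = (preStableFunctor F ξ).map g := by
  obtain ⟨P, hP, x, y, hxy⟩ := h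
  obtain ⟨b, hb⟩ := (ξ X).exists_map (ξ Y) (F.map ((Db.single A).map g))
  obtain ⟨bx, hbx⟩ := (ξ X).exists_map (ξ P) (F.map ((Db.single A).map x))
  obtain ⟨b_y, hby⟩ := (ξ P).exists_map (ξ Y) (F.map ((Db.single A).map y))
  have hM := (ξ P).projective_M hF hP
  obtain rfl : f = g + x ≫ y := by rw [← hxy]; abel
  rw [preStableFunctor_map F ξ g b hb, preStableFunctor_map F ξ _ (b + bx ≫ b_y)]
  · apply CategoryTheory.Quotient.sound
    exact ⟨_, hM, bx, b_y, by abel⟩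
  · rw [Functor.map_add, Functor.map_add, Functor.map_add, Preadditive.comp_add,
      Preadditive.add_comp, hb, Functor.map_comp, Functor.map_comp, Functor.map_comp,
      ← Category.assoc, hbx, Category.assoc, hby, Category.assoc]

/-- The stable functor of a non-negative triangle functor `F : D^b(A) ⥤ D^b(B)`, defined by
means of a choice of triangles `U_X ⟶ F(X) ⟶ M_X ⟶ U_X⟦1⟧` for all `X` in `A`. -/
def stableFunctor [F.CommShift ℤ] [F.IsTriangulated] (hF : IsNonNegative F)
    (ξ : ∀ X : A, StableTriangle F X) : StableCat A ⥤ StableCat B :=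
  CategoryTheory.Quotient.lift (stableRel A) (preStableFunctor F ξ) (preStableFunctor_map_eq F hF ξ)

end Functors

end StableFunctors

end

namespace StableFunctors

/-! ### Resolving an object with bounded cohomology by projectives, up to one object in degree 0. -/

section ProjComplex

variable {A : Type u} [Category.{v} A] [Abelian A] [HasDerivedCategory.{w} A]

/-! Existence: `F(X)` has cohomology in degrees `0, …, n`, by non-negativity and boundedness. Kill
the top cohomology by a map from a projective placed in that degree. The cone lives in one degree
less, and by induction one reaches an object `M` in degree 0 (`exists_triangle_isProjComplex`). The
octahedral axiom assembles the cone `V` of `F(X) ⟶ M` from the projectives used, so `U = V⟦-1⟧` is a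
complex of projectives in degrees `1, …, n + 1`.

Independence: maps from `U` to objects of `B` vanish, so every map `F(X) ⟶ F(Y)` induces some `M_X ⟶
M_Y`. Two such maps differ by one factoring through `U⟦1⟧`, hence through its projective degree 0
term, so the stable class is unique (`stableRel_of_comp_eq`). All functoriality, inverse and
naturality identities follow by checking them after `π_X`. For part (b), triangles for `F₂` are
transported to triangles for `F₁` with the same objects `M_X`, which reduces the claim to a change
of triangles for one functor. -/

lemma IsProjComplex.of_iso {a b : ℤ} {Y Y' : DerivedCategory A} (e : Y ≅ Y')
    (hY : IsProjComplex a b Y) : IsProjComplex a b Y' := by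
  obtain ⟨K, hK, hK', ⟨e'⟩⟩ := hY
  exact ⟨K, hK, hK', ⟨e.symm ≪≫ e'⟩⟩

lemma IsProjComplex.mono {a b a' b' : ℤ} {Y : DerivedCategory A} (hY : IsProjComplex a b Y)
    (ha : a' ≤ a) (hb : b ≤ b') : IsProjComplex a' b' Y := by
  obtain ⟨K, hK, hK', e⟩ := hY
  exact ⟨K, hK, fun i hi => hK' i (by omega), e⟩

lemma IsProjComplex.of_isZero (a b : ℤ) {Y : DerivedCategory A} (hY : IsZero Y) :
    IsProjComplex a b Y :=
  ⟨0, fun i => ((HomologicalComplex.eval A _ i).map_isZero (isZero_zero _)).projective,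
    fun i _ => (HomologicalComplex.eval A _ i).map_isZero (isZero_zero _),
    ⟨hY.iso (DerivedCategory.Q.map_isZero (isZero_zero _))⟩⟩

lemma isProjComplex_single (P : A) [Projective P] (n : ℤ) :
    IsProjComplex n n
      (DerivedCategory.Q.obj ((HomologicalComplex.single A (ComplexShape.up ℤ) n).obj P)) := by
  have h : ∀ i, i ≠ n →
      IsZero (((HomologicalComplex.single A (ComplexShape.up ℤ) n).obj P).X i) :=
    fun i hi => HomologicalComplex.isZero_single_obj_X _ _ _ _ hi
  refine ⟨_, fun i => ?_, fun i hi => h i (by omega), ⟨Iso.refl _⟩⟩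
  by_cases hi : i = n
  · subst hi
    exact Projective.of_iso (HomologicalComplex.singleObjXSelf _ i P).symm inferInstance
  · exact (h i hi).projective

lemma IsProjComplex.shift {a b : ℤ} {Y : DerivedCategory A} (hY : IsProjComplex a b Y)
    (n a' b' : ℤ) (ha : a' + n = a) (hb : b' + n = b) : IsProjComplex a' b' (Y⟦n⟧) := by
  obtain ⟨K, hK, hK', ⟨e⟩⟩ := hY
  exact ⟨K⟦n⟧, fun i => hK (i + n), fun i hi => hK' (i + n) (by omega),
    ⟨(shiftFunctor (DerivedCategory A) n).mapIso e ≪≫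
      ((DerivedCategory.Q (C := A)).commShiftIso n).symm.app K⟩⟩

/-- Complexes of projective objects in degrees `a, …, b` are stable under extensions. -/
lemma IsProjComplex.ext₂ {a b : ℤ} {T : Triangle (DerivedCategory A)}
    (hT : T ∈ distTriang (DerivedCategory A)) (h₁ : IsProjComplex a b T.obj₁)
    (h₃ : IsProjComplex a b T.obj₃) : IsProjComplex a b T.obj₂ := by
  obtain ⟨L, hL, hL', ⟨e₁⟩⟩ := h₁.shift 1 (a - 1) (b - 1) (by omega) (by omega)
  obtain ⟨K, hK, hK', ⟨e₃⟩⟩ := h₃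
  have := isKProjective_of_bounded hK hK'
  -- The connecting morphism lifts to a chain map `φ` because `K` is K-projective. Rotating `T`
  -- twice exhibits `T.obj₂⟦1⟧` as its cone, whose terms `K^{i+1} ⊞ L^i` are projective and vanish
  -- outside degrees `a - 1, …, b - 1`.
  obtain ⟨φ, hφ⟩ := exists_Q_map (e₃.inv ≫ T.mor₃ ≫ e₁.hom)
  let e := isoTriangleOfIso₁₂ _ _ (rot_of_distTriang _ (rot_of_distTriang _ hT))
    (DerivedCategory.mappingCone_triangle_distinguished φ) e₃ e₁
    (show T.mor₃ ≫ e₁.hom = e₃.hom ≫ DerivedCategory.Q.map φ by simp [hφ])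
  have e' : T.obj₂⟦(1 : ℤ)⟧ ≅ DerivedCategory.Q.obj (CochainComplex.mappingCone φ) :=
    Triangle.π₃.mapIso e
  have h : IsProjComplex (a - 1) (b - 1) (T.obj₂⟦(1 : ℤ)⟧) := by
    refine ⟨_, fun i => ?_, fun i hi => ?_, ⟨e'⟩⟩
    · exact Projective.of_iso
        (HomologicalComplex.homotopyCofiber.XIsoBiprod φ i (i + 1) rfl).symm
        (have := hK (i + 1); have := hL i; inferInstance)
    · refine IsZero.of_iso ?_ (HomologicalComplex.homotopyCofiber.XIsoBiprod φ i (i + 1) rfl)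
      rw [biprod_isZero_iff]
      exact ⟨hK' _ (by omega), hL' _ (by omega)⟩
  exact (h.shift (-1) a b (by omega) (by omega)).of_iso
    ((shiftFunctorCompIsoId (DerivedCategory A) (1 : ℤ) (-1) (by simp)).app T.obj₂)

/-- An object with cohomology in degrees `≤ n` receives a morphism from a projective object
placed in degree `n` which is an epimorphism on the cohomology in degree `n`. -/
lemma exists_epi_homologyFunctor_map [EnoughProjectives A] (Y : DerivedCategory A) (n : ℤ)
    [Y.IsLE n] : ∃ (S : DerivedCategory A) (_ : S.IsGE n) (_ : S.IsLE n) (f : S ⟶ Y),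
      IsProjComplex n n S ∧ Epi ((DerivedCategory.homologyFunctor A n).map f) := by
  obtain ⟨K, _, ⟨e⟩⟩ := DerivedCategory.exists_iso_Q_obj_of_isLE Y n
  have hd (j : ℤ) (hj : (ComplexShape.up ℤ).Rel n j) : K.d n j = 0 :=
    (K.isZero_of_isStrictlyLE n j (by simp at hj; omega)).eq_of_tgt _ _
  let g : (HomologicalComplex.single A (ComplexShape.up ℤ) n).obj (Projective.over (K.X n)) ⟶ K :=
    HomologicalComplex.mkHomFromSingle (Projective.π (K.X n)) (fun j hj => by rw [hd j hj, comp_zero])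
  have hf : Epi (g.f n) := by
    rw [HomologicalComplex.mkHomFromSingle_f]
    infer_instance
  -- No nonzero differential leaves degree `n` on either side, so cycles there are the whole term:
  -- the epimorphism `g.f n` passes to cycles, then to homology.
  have h₁ : IsIso (HomologicalComplex.iCycles
      ((HomologicalComplex.single A (ComplexShape.up ℤ) n).obj (Projective.over (K.X n))) n) :=
    HomologicalComplex.isIso_iCycles _ n (n + 1) (by simp) (by simp)
  have h₂ : IsIso (K.iCycles n) :=
    K.isIso_iCycles n (n + 1) (by simp) (hd _ (by simp))
  have h₃ : Epi (HomologicalComplex.cyclesMap g n) := by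
    have : HomologicalComplex.cyclesMap g n = HomologicalComplex.iCycles _ n ≫ g.f n ≫
        inv (K.iCycles n) := by simp [← HomologicalComplex.cyclesMap_i_assoc]
    rw [this]
    infer_instance
  have h₄ : Epi (HomologicalComplex.homologyMap g n) := by
    have : Epi (HomologicalComplex.homologyπ _ n ≫ HomologicalComplex.homologyMap g n) := by
      rw [HomologicalComplex.homologyπ_naturality]
      infer_instance
    exact epi_of_epi (HomologicalComplex.homologyπ _ n) _
  have h₅ : Epi ((DerivedCategory.homologyFunctor A n).map (DerivedCategory.Q.map g)) :=
    ((MorphismProperty.epimorphisms A).arrow_mk_iso_iff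
      (((Functor.mapArrowFunctor _ _).mapIso
        (DerivedCategory.homologyFunctorFactors A n)).app (Arrow.mk g))).2 h₄
  refine ⟨_, inferInstance, inferInstance, DerivedCategory.Q.map g ≫ e.inv,
    isProjComplex_single _ n, ?_⟩
  rw [Functor.map_comp]
  infer_instance

/-- Any object with cohomology in degrees `0, …, n` admits a morphism to an object in degree `0`
whose cone is a complex of projective objects in degrees `0, …, n`. -/
lemma exists_triangle_isProjComplex [EnoughProjectives A] (n : ℕ) (Y : DerivedCategory A)
    [Y.IsGE 0] [Y.IsLE n] :
    ∃ (M : A) (V : DerivedCategory A) (f : Y ⟶ (DerivedCategory.singleFunctor A 0).obj M)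
      (g : (DerivedCategory.singleFunctor A 0).obj M ⟶ V) (h : V ⟶ Y⟦(1 : ℤ)⟧),
      Triangle.mk f g h ∈ distTriang (DerivedCategory A) ∧ IsProjComplex 0 n V := by
  induction n generalizing Y with
  | zero =>
    obtain ⟨M, ⟨e⟩⟩ := DerivedCategory.exists_iso_singleFunctor_obj_of_isGE_of_isLE Y 0
    -- Cohomology only in degree 0: `Y` is already an object of `A`, and the cone is zero.
    exact ⟨M, 0, e.hom, 0, 0, isomorphic_distinguished _ (contractible_distinguished Y) _
      (Triangle.isoMk _ _ (Iso.refl _) e.symm (Iso.refl _) 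
        (e.hom_inv_id.trans (Category.comp_id _).symm) (zero_comp.trans comp_zero.symm)
        (zero_comp.trans comp_zero.symm)),
      IsProjComplex.of_isZero _ _ (isZero_zero _)⟩
  | succ n hn =>
    obtain ⟨S, _, _, f, hS, hf⟩ := exists_epi_homologyFunctor_map Y (n + 1 : ℕ)
    obtain ⟨Z, u, δ, hT⟩ := distinguished_cocone_triangle f
    have hT' := rot_of_distTriang _ hT
    have hZ₁ : Z.IsGE 0 := DerivedCategory.TStructure.t.isGE₂ _ hT' 0 (by assumption)
      (have := DerivedCategory.TStructure.t.isGE_shift S (n + 1 : ℕ) 1 n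
       DerivedCategory.TStructure.t.isGE_of_ge (S⟦(1 : ℤ)⟧) 0 n)
    have hZ₂ : Z.IsLE (n + 1 : ℕ) := DerivedCategory.TStructure.t.isLE₂ _ hT' _ (by assumption)
      (have := DerivedCategory.TStructure.t.isLE_shift S (n + 1 : ℕ) 1 n
       DerivedCategory.TStructure.t.isLE_of_le (S⟦(1 : ℤ)⟧) n (n + 1 : ℕ))
    -- In degree `n + 1`, the map from `H(Y)` to `H(Z)` is zero since `f` is epi on `H^{n+1}`, and
    -- `H^{n+2}(S) = 0`; exactness kills `H^{n+1}(Z)`.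
    have hZ₃ : Z.IsLE n := by
      rw [DerivedCategory.isLE_iff]
      intro i hi
      obtain rfl | hi := (show (n + 1 : ℕ) ≤ i by push_cast; omega).eq_or_lt
      · refine (DerivedCategory.HomologySequence.exact₃ _ hT (n + 1 : ℕ) (n + 2 : ℕ)
          (by push_cast; omega)).isZero_of_both_zeros
          ((DerivedCategory.HomologySequence.epi_homologyMap_mor₁_iff _ hT _).1 hf)
          ((DerivedCategory.isZero_of_isLE S (n + 1 : ℕ) (n + 2 : ℕ)
            (by push_cast; omega)).eq_of_tgt _ _)
      · exact DerivedCategory.isZero_of_isLE Z (n + 1 : ℕ) i hi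
    obtain ⟨M, V₂, p, q, r, h₂, hV₂⟩ := hn Z
    obtain ⟨V, q', r', h⟩ := distinguished_cocone_triangle (u ≫ p)
    exact ⟨M, V, u ≫ p, q', r', h,
      -- The octahedron places `V` between `S⟦1⟧`, the cone of `u`, which sits in degree `n`, and
      -- `V₂`, the cone of `p`.
      IsProjComplex.ext₂ (Triangulated.someOctahedron rfl hT' h₂ h).mem
        ((hS.shift 1 n n (by simp) (by simp)).mono (by simp) (by simp))
        (hV₂.mono le_rfl (by simp))⟩

end ProjComplex

end StableFunctors

noncomputable section

namespace StableFunctors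

/-! ### Existence of the triangles and comparison of stable functors. -/

section Functors

variable {A : Type u₁} [Category.{v₁} A] [Abelian A] [HasDerivedCategory.{w₁} A]
  {B : Type u₂} [Category.{v₂} B] [Abelian B] [HasDerivedCategory.{w₂} B]

lemma IsNonNegative.nonempty_stableTriangle [EnoughProjectives B] {F : Db A ⥤ Db B}
    (hF : IsNonNegative F) (X : A) : Nonempty (StableTriangle F X) := by
  let Y : Db B := F.obj ((Db.single A).obj X)
  have h₀ : Y.obj.IsGE 0 := by
    rw [DerivedCategory.isGE_iff]
    exact hF.isZero_homology X
  obtain ⟨n, hn⟩ : ∃ n : ℕ, Y.obj.IsLE n := by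
    obtain ⟨b, hb⟩ := Y.property.2
    exact ⟨b.toNat, DerivedCategory.TStructure.t.isLE_of_le Y.obj b b.toNat⟩
  obtain ⟨M, V, f, g, h, hT, hV⟩ := exists_triangle_isProjComplex n Y.obj
  -- The triangle just found lives in `D(B)`. Completing `π` inside `D^b(B)` gives a bounded `U`;
  -- uniqueness of cones identifies `V` with `U⟦1⟧`.
  let π : Y ⟶ (Db.single B).obj M := ObjectProperty.homMk f
  obtain ⟨U, i, μ, hU⟩ := distinguished_cocone_triangle₁ π
  refine ⟨⟨U, M, i, π, μ, hU, n + 1, by omega, ?_⟩⟩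
  obtain ⟨e, -, -⟩ := exists_iso_of_arrow_iso _ _ hT
    (rot_of_distTriang _ ((Db.ι B).map_distinguished _ hU)) (Iso.refl _)
  have e₁ : V ≅ ((Db.ι B).obj U)⟦(1 : ℤ)⟧ := Triangle.π₃.mapIso e
  exact ((hV.of_iso e₁).shift (-1) 1 (n + 1) (by omega) (by omega)).of_iso
    ((shiftFunctorCompIsoId (DerivedCategory B) (1 : ℤ) (-1) (by simp)).app _)

/-- Transport of a triangle `U_X ⟶ G(X) ⟶ M_X ⟶ U_X⟦1⟧` along an isomorphism `F ≅ G`. -/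
def StableTriangle.ofIso {F G : Db A ⥤ Db B} (e : F ≅ G) {X : A} (T : StableTriangle G X) :
    StableTriangle F X where
  U := T.U
  M := T.M
  i := T.i ≫ e.inv.app _
  π := e.hom.app _ ≫ T.π
  μ := T.μ
  distinguished := isomorphic_distinguished _ T.distinguished _
    (Triangle.isoMk _ _ (Iso.refl _) (e.app _) (Iso.refl _)
      (show (T.i ≫ e.inv.app _) ≫ e.hom.app _ = 𝟙 _ ≫ T.i by simp)
      (show (e.hom.app _ ≫ T.π) ≫ 𝟙 _ = e.hom.app _ ≫ T.π from Category.comp_id _)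
      (show T.μ ≫ (𝟙 T.U)⟦(1 : ℤ)⟧' = 𝟙 _ ≫ T.μ by simp))
  isProjComplex := T.isProjComplex

variable {F G : Db A ⥤ Db B}

/-- Two triangles `U ⟶ F(X) ⟶ M ⟶ U⟦1⟧` and `U' ⟶ F(X) ⟶ M' ⟶ U'⟦1⟧` give isomorphic
objects `M` and `M'` in the stable category. -/
def StableTriangle.isoM {X : A} (S T : StableTriangle F X) :
    (toStable B).obj S.M ≅ (toStable B).obj T.M where
  hom := (toStable B).map (S.exists_map T (𝟙 _)).choose
  inv := (toStable B).map (T.exists_map S (𝟙 _)).choose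
  hom_inv_id := by
    rw [← Functor.map_comp, ← (toStable B).map_id]
    apply CategoryTheory.Quotient.sound
    -- Both the composite and the identity of `S.M` are compatible with the identity of `F(X)`.
    apply S.stableRel_of_comp_eq
    rw [Functor.map_comp, ← Category.assoc, (S.exists_map T (𝟙 _)).choose_spec, Category.assoc,
      (T.exists_map S (𝟙 _)).choose_spec]
    simp
  inv_hom_id := by
    rw [← Functor.map_comp, ← (toStable B).map_id]
    apply CategoryTheory.Quotient.sound
    apply T.stableRel_of_comp_eq
    rw [Functor.map_comp, ← Category.assoc, (T.exists_map S (𝟙 _)).choose_spec, Category.assoc,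
      (S.exists_map T (𝟙 _)).choose_spec]
    simp

/-- Different choices of triangles define isomorphic functors. -/
def preStableFunctorIso (ξ ξ' : ∀ X : A, StableTriangle F X) :
    preStableFunctor F ξ ≅ preStableFunctor F ξ' :=
  NatIso.ofComponents (fun X => (ξ X).isoM (ξ' X)) (fun {X Y} f => by
    obtain ⟨b, hb⟩ := (ξ X).exists_map (ξ Y) (F.map ((Db.single A).map f))
    obtain ⟨b', hb'⟩ := (ξ' X).exists_map (ξ' Y) (F.map ((Db.single A).map f))
    have hX := ((ξ X).exists_map (ξ' X) (𝟙 _)).choose_spec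
    have hY := ((ξ Y).exists_map (ξ' Y) (𝟙 _)).choose_spec
    rw [preStableFunctor_map F ξ f b hb, preStableFunctor_map F ξ' f b' hb']
    refine ((toStable B).map_comp _ _).symm.trans (Eq.trans ?_ ((toStable B).map_comp _ _))
    apply CategoryTheory.Quotient.sound
    -- After `π_X`, both ways around the square become `F(f)` followed by the projection to the
    -- second choice of `M_Y`.
    apply (ξ X).stableRel_of_comp_eq
    rw [Functor.map_comp, Functor.map_comp, ← Category.assoc, hb, Category.assoc, hY,
      ← Category.assoc (ξ X).π, hX, Category.id_comp, Category.id_comp, hb'])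

/-- The functors defined by triangles for `G` and by their transports along an isomorphism
`F ≅ G` are isomorphic. -/
def preStableFunctorOfIso (e : F ≅ G) (ξ : ∀ X : A, StableTriangle G X) :
    preStableFunctor F (fun X => (ξ X).ofIso e) ≅ preStableFunctor G ξ :=
  NatIso.ofComponents (fun X => Iso.refl _) (fun {X Y} f => by
    obtain ⟨b, hb⟩ := (ξ X).exists_map (ξ Y) (G.map ((Db.single A).map f))
    -- The same `b` represents both images of `f`, by naturality of `e`.
    rw [preStableFunctor_map G ξ f b hb, preStableFunctor_map F (fun X => (ξ X).ofIso e) f b]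
    · exact (Category.comp_id _).trans (Category.id_comp _).symm
    · have h : (e.hom.app _ ≫ (ξ X).π) ≫ (Db.single B).map b =
          F.map ((Db.single A).map f) ≫ e.hom.app _ ≫ (ξ Y).π := by
        rw [Category.assoc, hb, NatTrans.naturality_assoc]
      exact h)

/-- Isomorphic non-negative triangle functors have isomorphic stable functors, for any choices of
triangles. -/
def stableFunctorIso [F.CommShift ℤ] [F.IsTriangulated] [G.CommShift ℤ] [G.IsTriangulated]
    (hF : IsNonNegative F) (hG : IsNonNegative G) (e : F ≅ G)
    (ξ : ∀ X : A, StableTriangle F X) (ξ' : ∀ X : A, StableTriangle G X) :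
    stableFunctor F hF ξ ≅ stableFunctor G hG ξ' :=
  -- An isomorphism between functors on the stable category may be built after restriction to `A`.
  -- The intermediate choice is `ξ'` transported along `e`.
  CategoryTheory.Quotient.natIsoLift _
    (CategoryTheory.Quotient.lift.isLift _ _ _ ≪≫ preStableFunctorIso ξ _ ≪≫
      preStableFunctorOfIso e ξ' ≪≫ (CategoryTheory.Quotient.lift.isLift _ _ _).symm)

end Functors

end StableFunctors

end

theorem mainTheorem3
    {A : Type u₁} [Category.{v₁} A] [Abelian A] [EnoughProjectives A] [HasDerivedCategory.{w₁} A]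
    {B : Type u₂} [Category.{v₂} B] [Abelian B] [EnoughProjectives B] [HasDerivedCategory.{w₂} B] :
    -- the triangles which are used in the definition of the stable functor exist, and
    -- different choices of them give isomorphic stable functors
    (∀ (F : StableFunctors.Db A ⥤ StableFunctors.Db B) [F.CommShift ℤ] [F.IsTriangulated]
        (hF : StableFunctors.IsNonNegative F),
      (∀ X : A, Nonempty (StableFunctors.StableTriangle F X)) ∧
      ∀ ξ ξ' : (∀ X : A, StableFunctors.StableTriangle F X),
        Nonempty (StableFunctors.stableFunctor F hF ξ ≅ StableFunctors.stableFunctor F hF ξ')) ∧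
    -- isomorphic non-negative triangle functors have isomorphic stable functors
    (∀ (F₁ F₂ : StableFunctors.Db A ⥤ StableFunctors.Db B)
        [F₁.CommShift ℤ] [F₁.IsTriangulated] [F₂.CommShift ℤ] [F₂.IsTriangulated]
        (hF₁ : StableFunctors.IsNonNegative F₁) (hF₂ : StableFunctors.IsNonNegative F₂),
      Nonempty (F₁ ≅ F₂) →
      ∀ (ξ₁ : ∀ X : A, StableFunctors.StableTriangle F₁ X)
        (ξ₂ : ∀ X : A, StableFunctors.StableTriangle F₂ X),
        Nonempty (StableFunctors.stableFunctor F₁ hF₁ ξ₁ ≅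
          StableFunctors.stableFunctor F₂ hF₂ ξ₂)) := by
  exact ⟨fun F _ _ hF => ⟨hF.nonempty_stableTriangle,
      -- Independence of choices is the case of the identity isomorphism.
      fun ξ ξ' => ⟨StableFunctors.stableFunctorIso hF hF (Iso.refl F) ξ ξ'⟩⟩,
    fun _ _ _ _ _ _ hF₁ hF₂ ⟨e⟩ ξ₁ ξ₂ =>
      ⟨StableFunctors.stableFunctorIso hF₁ hF₂ e ξ₁ ξ₂⟩⟩
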